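/- Let $B=(B_t)_{t\ge 0}$ be a standard one-dimensional Brownian motion on a probability space $(\Omega,\mathcal A,P)$, and for $0\le s<t<\infty$ let $\mathcal F_{s,t}=\sigma(B_v : v\le s\text{ or }v\ge t)$, augmented by the $P$-null events. A family $(X_{s,t})_{0\le s<t<\infty}$ of random variables is called a past-future martingale if, for all $0\le s<t$, $X_{s,t}$ is integrable and $\mathcal F_{s,t}$-measurable, and $E[X_{s,t}\mid\mathcal F_{r,u}]=X_{r,u}$ almost surely for all $0\le r<s<t<u$. Let $f_-,f_+:\mathbb R_+\to\mathbb R$ be two functions that are both integrable and square-integrable with respect to Lebesgue measure, and let $C\in\mathbb R$. For $0\le s<t$ put $$c_{s,t}=C-\int_0^s f_-(u)\,du-\int_t^\infty f_+(u)\,du ,$$ $$M_{s,t}=\int_0^s f_-(u)\,dB_u+\int_t^\infty f_+(u)\,dB_u+\frac{B_t-B_s}{t-s}\,c_{s,t},$$ $$N_{s,t}=\exp\Big(M_{s,t}-\tfrac12\int_0^s f_-(u)^2\,du-\tfrac12\int_t^\infty f_+(u)^2\,du-\frac{1}{2(t-s)}\,c_{s,t}^2\Big),$$ where the integrals with respect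 to $B$ are Wiener integrals, that is, limits in $L^2(P)$ of the elementary integrals of step functions converging to the integrand in $L^2(\mathbb R_+)$. Then these Wiener integrals exist, and both $(M_{s,t})_{0\le s<t<\infty}$ and $(N_{s,t})_{0\le s<t<\infty}$ are past-future martingales. -/

import Mathlib

open MeasureTheory ProbabilityTheory Filter
open scoped NNReal ENNReal Topology

namespace PastFuture

/-- A past-future filtration: sub-σ-algebras `F s t`, `0 ≤ s < t < ∞`, which grow when the
interval `(s, t)` shrinks. Values at pairs with `t ≤ s` are irrelevant. -/
structure PastFutureFiltration (Ω : Type*) (mΩ : MeasurableSpace Ω) where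
  seq : ℝ≥0 → ℝ≥0 → MeasurableSpace Ω
  le : ∀ s t, s < t → seq s t ≤ mΩ
  mono : ∀ r s t u, r ≤ s → s < t → t ≤ u → seq r u ≤ seq s t

/-- Past-future martingales with respect to a past-future filtration. -/
structure IsPastFutureMartingale {Ω : Type*} {mΩ : MeasurableSpace Ω}
    (M : ℝ≥0 → ℝ≥0 → Ω → ℝ) (F : PastFutureFiltration Ω mΩ) (P : Measure Ω) : Prop where
  integrable : ∀ s t, s < t → Integrable (M s t) P
  measurable : ∀ s t, s < t → Measurable[F.seq s t] (M s t)
  condExp_eq : ∀ r s t u, r < s → s < t → t < u → P[M s t | F.seq r u] =ᵐ[P] M r u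

/-- The σ-algebra generated by the `P`-null events. -/
abbrev nullEvents {Ω : Type*} {mΩ : MeasurableSpace Ω} (P : Measure Ω) : MeasurableSpace Ω :=
  MeasurableSpace.generateFrom {A : Set Ω | MeasurableSet A ∧ P A = 0}

theorem nullEvents_le {Ω : Type*} {mΩ : MeasurableSpace Ω} (P : Measure Ω) :
    nullEvents P ≤ mΩ :=
  MeasurableSpace.generateFrom_le fun _ hA => hA.1

/-- The past-future filtration of a process `B`: `σ(B v ; v ≤ s or v ≥ t)`, augmented by the
`P`-null events. -/
def naturalPastFuture {Ω : Type*} {mΩ : MeasurableSpace Ω} (B : ℝ≥0 → Ω → ℝ)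
    (hB : ∀ t, Measurable (B t)) (P : Measure Ω) : PastFutureFiltration Ω mΩ where
  seq s t :=
    (⨆ v ∈ {v : ℝ≥0 | v ≤ s ∨ t ≤ v}, MeasurableSpace.comap (B v) inferInstance) ⊔ nullEvents P
  le _ _ _ := sup_le (iSup₂_le fun v _ => (hB v).comap_le) (nullEvents_le P)
  mono _ _ _ _ hrs _ htu :=
    sup_le_sup_right
      (biSup_mono fun _ hv => hv.elim (fun h => Or.inl (h.trans hrs)) fun h => Or.inr (htu.trans h))
      _

/-- Step functions `∑ i, coeff i * 1_{(left i, right i]}` on `[0, ∞)`. -/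
structure StepFunction where
  n : ℕ
  left : Fin n → ℝ≥0
  right : Fin n → ℝ≥0
  left_le_right : ∀ i, left i ≤ right i
  coeff : Fin n → ℝ

/-- The step function as a function of a real variable. -/
noncomputable def StepFunction.eval (φ : StepFunction) (x : ℝ) : ℝ :=
  ∑ i, φ.coeff i * (Set.Ioc (φ.left i : ℝ) (φ.right i)).indicator (fun _ => (1 : ℝ)) x

/-- The elementary stochastic integral of a step function against a process. -/
noncomputable def StepFunction.integral {Ω : Type*} (φ : StepFunction) (B : ℝ≥0 → Ω → ℝ)
    (ω : Ω) : ℝ :=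
  ∑ i, φ.coeff i * (B (φ.right i) ω - B (φ.left i) ω)

/-- The random variable `I` is a version of the Wiener integral `∫_0^∞ f dB`: it is the limit in
`L²(P)` of the elementary integrals of step functions which converge to `f` in `L²([0, ∞))`. -/
def IsWienerIntegral {Ω : Type*} {mΩ : MeasurableSpace Ω} (B : ℝ≥0 → Ω → ℝ) (P : Measure Ω)
    (f : ℝ → ℝ) (I : Ω → ℝ) : Prop :=
  Measurable I ∧ ∃ φ : ℕ → StepFunction,
    Tendsto (fun k => eLpNorm (fun x => (φ k).eval x - f x) 2 (volume.restrict (Set.Ici 0)))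
      atTop (𝓝 0) ∧
    Tendsto (fun k => eLpNorm (fun ω => (φ k).integral B ω - I ω) 2 P) atTop (𝓝 0)

open Classical in
/-- A version of the Wiener integral `∫_0^∞ f dB` (zero if there is none). -/
noncomputable def wienerIntegral {Ω : Type*} {mΩ : MeasurableSpace Ω} (B : ℝ≥0 → Ω → ℝ)
    (P : Measure Ω) (f : ℝ → ℝ) : Ω → ℝ :=
  if h : ∃ I, IsWienerIntegral B P f I then h.choose else 0

/-- `∫_0^s f dB`. -/
noncomputable def pastIntegral {Ω : Type*} {mΩ : MeasurableSpace Ω} (B : ℝ≥0 → Ω → ℝ)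
    (P : Measure Ω) (f : ℝ → ℝ) (s : ℝ≥0) : Ω → ℝ :=
  wienerIntegral B P ((Set.Ioc (0 : ℝ) s).indicator f)

/-- `∫_t^∞ f dB`. -/
noncomputable def futureIntegral {Ω : Type*} {mΩ : MeasurableSpace Ω} (B : ℝ≥0 → Ω → ℝ)
    (P : Measure Ω) (f : ℝ → ℝ) (t : ℝ≥0) : Ω → ℝ :=
  wienerIntegral B P ((Set.Ioi (t : ℝ)).indicator f)

/-- `C - ∫_0^s f₋ du - ∫_t^∞ f₊ du`. -/
noncomputable def harnessCoeff (fm fp : ℝ → ℝ) (C : ℝ) (s t : ℝ≥0) : ℝ :=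
  C - (∫ u in (0 : ℝ)..s, fm u) - ∫ u in Set.Ioi (t : ℝ), fp u

/-- The process `M` built from `f₋`, `f₊` and `C`. -/
noncomputable def linearProcess {Ω : Type*} {mΩ : MeasurableSpace Ω} (B : ℝ≥0 → Ω → ℝ)
    (P : Measure Ω) (fm fp : ℝ → ℝ) (C : ℝ) (s t : ℝ≥0) (ω : Ω) : ℝ :=
  pastIntegral B P fm s ω + futureIntegral B P fp t ω
    + (B t ω - B s ω) / ((t : ℝ) - s) * harnessCoeff fm fp C s t

/-- The exponential process `N` associated with `M`. -/
noncomputable def exponentialProcess {Ω : Type*} {mΩ : MeasurableSpace Ω} (B : ℝ≥0 → Ω → ℝ)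
    (P : Measure Ω) (fm fp : ℝ → ℝ) (C : ℝ) (s t : ℝ≥0) (ω : Ω) : ℝ :=
  Real.exp (linearProcess B P fm fp C s t ω
    - 1 / 2 * (∫ u in (0 : ℝ)..s, fm u ^ 2)
    - 1 / 2 * (∫ u in Set.Ioi (t : ℝ), fp u ^ 2)
    - 1 / (2 * ((t : ℝ) - s)) * harnessCoeff fm fp C s t ^ 2)

end PastFuture

/-! For `s < t`, $M_{s,t}$ is one Wiener integral $\int h_{s,t}\,dB$, where $h_{s,t}$ is $f_-$ on
$(0,s]$, $f_+$ on $(t,\infty)$ and the constant $c_{s,t}/(t-s)$ on $(s,t]$ (`harnessIntegrand`). The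
choice of $c_{s,t}$ makes $\int_0^v h_{s,t}$ equal to $\int_0^v f_-$ for $v\le s$ and to
$C-\int_v^\infty f_+$ for $v\ge t$; neither value depends on $(s,t)$. Hence, for $r<s<t<u$, the
difference $h_{s,t}-h_{r,u}$ is orthogonal in $L^2$ to $1_{(0,v]}$ whenever $v\le r$ or $v\ge u$.

Wiener integrals are jointly Gaussian with covariance $\int fg$, and $B_v$ is almost surely the
integral of $1_{(0,v]}$. So orthogonality means that $D=M_{s,t}-M_{r,u}$ is independent of $\mathcal
F_{r,u}$ (`IsWienerIntegral.indep`, `indep_linearProcess_sub`). As $D$ is centered, $M$ is a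
past-future martingale. Moreover $N_{s,t}=\exp(M_{s,t}-\tfrac12\mathrm{Var}\,M_{s,t})$, and
variances add over independent summands, so $N_{s,t}$ is $N_{r,u}$ times an independent factor of
mean one.

The remaining work constructs the Wiener integral: isometry on step functions, their density in
$L^2$, and passage of laws and measurability to the limit. -/

namespace PastFuture

/-! ### Algebra and truncation of step functions. -/

namespace StepFunction

/-- The sum of two step functions. -/
def add (φ ψ : StepFunction) : StepFunction where
  n := φ.n + ψ.n
  left := Fin.append φ.left ψ.left
  right := Fin.append φ.right ψ.right
  left_le_right i := by
    refine Fin.addCases (fun i => ?_) (fun i => ?_) i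
    · simpa using φ.left_le_right i
    · simpa using ψ.left_le_right i
  coeff := Fin.append φ.coeff ψ.coeff

/-- The product of a step function with a constant. -/
def smul (c : ℝ) (φ : StepFunction) : StepFunction where
  n := φ.n
  left := φ.left
  right := φ.right
  left_le_right := φ.left_le_right
  coeff i := c * φ.coeff i

/-- The step function `1_{(a, b]}`. -/
def single (a b : ℝ≥0) (h : a ≤ b) : StepFunction where
  n := 1
  left _ := a
  right _ := b
  left_le_right _ := h
  coeff _ := 1

/-- The restriction of a step function to `(a, b]`. -/
def clamp (a b : ℝ≥0) (φ : StepFunction) : StepFunction where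
  n := φ.n
  left i := (φ.left i ⊔ a) ⊓ b
  right i := (φ.right i ⊔ a) ⊓ b
  left_le_right i := inf_le_inf_right _ (sup_le_sup_right (φ.left_le_right i) _)
  coeff := φ.coeff

/-- The restriction of a step function to `(a, ∞)`. -/
def clampLeft (a : ℝ≥0) (φ : StepFunction) : StepFunction where
  n := φ.n
  left i := φ.left i ⊔ a
  right i := φ.right i ⊔ a
  left_le_right i := sup_le_sup_right (φ.left_le_right i) _
  coeff := φ.coeff

variable {Ω : Type*} (B : ℝ≥0 → Ω → ℝ) (φ ψ : StepFunction)

theorem eval_add (x : ℝ) : (φ.add ψ).eval x = φ.eval x + ψ.eval x := by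
  unfold eval add
  simp [Fin.sum_univ_add]

theorem integral_add (ω : Ω) : (φ.add ψ).integral B ω = φ.integral B ω + ψ.integral B ω := by
  unfold integral add
  simp [Fin.sum_univ_add]

theorem eval_smul (c x : ℝ) : (smul c φ).eval x = c * φ.eval x := by
  simp only [eval, smul, Finset.mul_sum, mul_assoc]
  rfl

theorem integral_smul (c : ℝ) (ω : Ω) : (smul c φ).integral B ω = c * φ.integral B ω := by
  simp only [integral, smul, Finset.mul_sum, mul_assoc]
  rfl

theorem eval_single (a b : ℝ≥0) (h : a ≤ b) (x : ℝ) :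
    (single a b h).eval x = (Set.Ioc (a : ℝ) b).indicator (fun _ => (1 : ℝ)) x := by
  exact (Fin.sum_univ_one _).trans (one_mul _)

theorem integral_single (a b : ℝ≥0) (h : a ≤ b) (ω : Ω) :
    (single a b h).integral B ω = B b ω - B a ω := by
  exact (Fin.sum_univ_one _).trans (one_mul _)

/-- Intervals that miss `(a, b]` collapse to empty ones. The elementary integral of the clamped
function therefore uses `B` only at times in `[a, b]`, which is what measurability of the past
integral needs. -/
theorem eval_clamp (a b : ℝ≥0) (x : ℝ) :
    (φ.clamp a b).eval x = (Set.Ioc (a : ℝ) b).indicator φ.eval x := by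
  rw [Set.indicator_apply]
  unfold eval clamp
  split_ifs with h
  · refine Finset.sum_congr rfl fun i _ => ?_
    simp only [Set.mem_Ioc] at h
    simp only [Set.indicator_apply, Set.mem_Ioc, NNReal.coe_min, NNReal.coe_max, inf_lt_iff,
      le_inf_iff, sup_lt_iff, le_sup_iff]
    congr 2
    grind
  · refine Finset.sum_eq_zero fun i _ => ?_
    rw [Set.indicator_of_notMem, mul_zero]
    have := NNReal.coe_le_coe.2 (φ.left_le_right i)
    simp only [Set.mem_Ioc, NNReal.coe_min, NNReal.coe_max, inf_lt_iff,
      le_inf_iff, sup_lt_iff, le_sup_iff] at h ⊢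
    grind

theorem eval_clampLeft (a : ℝ≥0) (x : ℝ) :
    (φ.clampLeft a).eval x = (Set.Ioi (a : ℝ)).indicator φ.eval x := by
  rw [Set.indicator_apply]
  unfold eval clampLeft
  split_ifs with h
  · refine Finset.sum_congr rfl fun i _ => ?_
    simp only [Set.mem_Ioi] at h
    simp only [Set.indicator_apply, Set.mem_Ioc, NNReal.coe_max, sup_lt_iff, le_sup_iff]
    congr 2
    grind
  · refine Finset.sum_eq_zero fun i _ => ?_
    rw [Set.indicator_of_notMem, mul_zero]
    have := NNReal.coe_le_coe.2 (φ.left_le_right i)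
    simp only [Set.mem_Ioi, Set.mem_Ioc, NNReal.coe_max, sup_lt_iff, le_sup_iff] at h ⊢
    grind

theorem memLp_indicator_Ioc (a b : ℝ) (p : ℝ≥0∞) :
    MemLp ((Set.Ioc a b).indicator fun _ => (1 : ℝ)) p (volume.restrict (Set.Ici 0)) :=
  (memLp_indicator_const p measurableSet_Ioc 1 (Or.inr (by simp))).restrict _

theorem memLp_eval (p : ℝ≥0∞) : MemLp φ.eval p (volume.restrict (Set.Ici 0)) := by
  unfold eval
  exact memLp_finsetSum _ fun i _ => (memLp_indicator_Ioc _ _ p).const_mul _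

/-- The right side has the shape of the expanded covariance of two Brownian increments, since `B`
has covariance `min`. -/
theorem setIntegral_indicator_Ioc_mul (a b a' b' : ℝ≥0) (h : a ≤ b) (h' : a' ≤ b') :
    ∫ x in Set.Ici (0 : ℝ), (Set.Ioc (a : ℝ) b).indicator (fun _ => (1 : ℝ)) x *
      (Set.Ioc (a' : ℝ) b').indicator (fun _ => (1 : ℝ)) x =
      min (b : ℝ) b' - min (b : ℝ) a' - min (a : ℝ) b' + min (a : ℝ) a' := by
  have h0 := a.2
  have h0' := a'.2
  have h := NNReal.coe_le_coe.2 h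
  have h' := NNReal.coe_le_coe.2 h'
  simp only [← Set.inter_indicator_mul, mul_one, Set.Ioc_inter_Ioc]
  rw [integral_indicator measurableSet_Ioc, Measure.restrict_restrict measurableSet_Ioc,
    Set.inter_eq_left.2]
  · simp only [integral_const, MeasurableSet.univ, measureReal_restrict_apply, Set.univ_inter,
      Real.volume_real_Ioc, smul_eq_mul, mul_one]
    grind
  · intro x hx
    exact (h0.trans (le_sup_left.trans hx.1.le) : (0 : ℝ) ≤ x)

end StepFunction

/-! ### Elementary integrals: Gaussian law and isometry. -/

section Brownian

variable {Ω : Type*} {mΩ : MeasurableSpace Ω} {P : Measure Ω} {B : ℝ≥0 → Ω → ℝ}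
  (hB : IsPreBrownianReal B P) (φ : StepFunction)

include hB

theorem hasGaussianLaw_stepIntegral : HasGaussianLaw (φ.integral B) P := by
  have : IsGaussianProcess (fun i ω => φ.coeff i * (B (φ.right i) ω - B (φ.left i) ω)) P :=
    hB.isGaussianProcess.of_isGaussianProcess fun i => ⟨{φ.right i, φ.left i},
      φ.coeff i • (ContinuousLinearMap.proj ⟨φ.right i, by simp⟩ -
        ContinuousLinearMap.proj ⟨φ.left i, by simp⟩), fun ω => by simp⟩
  exact this.hasGaussianLaw_fun_sum (I := Finset.univ)

theorem integral_stepIntegral : P[φ.integral B] = 0 := by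
  unfold StepFunction.integral
  rw [integral_finsetSum]
  · simp [integral_const_mul, integral_sub (hB.integrable_eval _) (hB.integrable_eval _),
      hB.integral_eval]
  · exact fun i _ => ((hB.integrable_eval _).sub (hB.integrable_eval _)).const_mul _

/-- The intervals of a step function may overlap, so the increments need not be independent; the
full double sums of covariances and of overlaps are matched term by term. -/
theorem variance_stepIntegral :
    Var[φ.integral B; P] = ∫ x in Set.Ici (0 : ℝ), φ.eval x ^ 2 := by
  have := hB.isGaussianProcess.isProbabilityMeasure
  have hL (t) : MemLp (B t) 2 P := (hB.isGaussianProcess.hasGaussianLaw_eval t).memLp_two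
  have h1 : φ.integral B = ∑ i, fun ω => φ.coeff i * (B (φ.right i) ω - B (φ.left i) ω) := by
    ext ω; simp [StepFunction.integral]
  have h2 (i) : MemLp (fun ω => φ.coeff i * (B (φ.right i) ω - B (φ.left i) ω)) 2 P :=
    ((hL _).sub (hL _)).const_mul _
  rw [h1, variance_sum h2]
  simp_rw [StepFunction.eval, sq, Finset.sum_mul_sum]
  rw [integral_finsetSum]
  · refine Finset.sum_congr rfl fun i _ => ?_
    rw [integral_finsetSum]
    · refine Finset.sum_congr rfl fun j _ => ?_
      simp_rw [mul_mul_mul_comm]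
      rw [integral_const_mul, StepFunction.setIntegral_indicator_Ioc_mul _ _ _ _
        (φ.left_le_right i) (φ.left_le_right j), covariance_const_mul_left,
        covariance_const_mul_right, covariance_fun_sub_fun_sub (hL _) (hL _) (hL _) (hL _)]
      simp only [hB.covariance_fun_eval, NNReal.coe_min]
      ring
    · exact fun j _ => ((StepFunction.memLp_indicator_Ioc _ _ 2).const_mul _).integrable_mul
        ((StepFunction.memLp_indicator_Ioc _ _ 2).const_mul _)
  · exact fun i _ => integrable_finsetSum _ fun j _ =>
      ((StepFunction.memLp_indicator_Ioc _ _ 2).const_mul _).integrable_mul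
        ((StepFunction.memLp_indicator_Ioc _ _ 2).const_mul _)

theorem eLpNorm_stepIntegral :
    eLpNorm (φ.integral B) 2 P = eLpNorm φ.eval 2 (volume.restrict (Set.Ici 0)) := by
  have := hB.isGaussianProcess.isProbabilityMeasure
  have hI := (hasGaussianLaw_stepIntegral hB φ).memLp_two
  rw [hI.eLpNorm_eq_integral_rpow_norm (by simp) (by simp),
    (φ.memLp_eval 2).eLpNorm_eq_integral_rpow_norm (by simp) (by simp)]
  have h := variance_stepIntegral hB φ
  rw [variance_of_integral_eq_zero hI.aemeasurable (integral_stepIntegral hB φ)] at h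
  simp [h]

end Brownian

/-! ### Density of step functions in $L^2([0,\infty))$. -/

/-- A function which is square-integrable on `[0, ∞)` and whose integral over every interval
`(a, b]` vanishes is zero almost everywhere. -/
theorem ae_eq_zero_of_forall_setIntegral_Ioc_eq_zero {f : ℝ → ℝ}
    (hf : MemLp f 2 (volume.restrict (Set.Ici 0)))
    (h : ∀ b : ℝ≥0, ∫ x in Set.Ioc (0 : ℝ) b, f x = 0) :
    f =ᵐ[volume.restrict (Set.Ici 0)] 0 := by
  -- Extension by zero to the whole line gives access to Lebesgue differentiation: `g` is almost
  -- everywhere the derivative of its primitive, which vanishes identically.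
  set g := (Set.Ici (0 : ℝ)).indicator f with hg
  have hg2 : MemLp g 2 volume := (memLp_indicator_iff_restrict measurableSet_Ici).2 hf
  have hloc : LocallyIntegrable g volume := hg2.locallyIntegrable (by norm_num)
  have hz (b : ℝ) : ∫ x in (0 : ℝ)..b, g x = 0 := by
    rcases le_total 0 b with hb | hb
    · rw [intervalIntegral.integral_of_le hb]
      refine Eq.trans (setIntegral_congr_fun measurableSet_Ioc fun x hx => ?_) (h ⟨b, hb⟩)
      exact Set.indicator_of_mem (show x ∈ Set.Ici (0 : ℝ) from hx.1.le) f
    · rw [intervalIntegral.integral_of_ge hb, neg_eq_zero, integral_Ioc_eq_integral_Ioo]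
      refine setIntegral_eq_zero_of_forall_eq_zero fun x hx => ?_
      exact Set.indicator_of_notMem (by simpa using hx.2) f
  have hd := LocallyIntegrable.ae_hasDerivAt_integral hloc
  rw [EventuallyEq, ae_restrict_iff' measurableSet_Ici]
  filter_upwards [hd] with x hx hx0
  have h1 := hx 0
  simp only [hz] at h1
  have := h1.unique (hasDerivAt_const x 0)
  rwa [hg, Set.indicator_of_mem hx0] at this

/-- Step functions are dense in `L²([0, ∞))`. -/
theorem exists_stepFunction_tendsto {f : ℝ → ℝ} (hf : MemLp f 2 (volume.restrict (Set.Ici 0))) :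
    ∃ φ : ℕ → StepFunction, Tendsto
      (fun k => eLpNorm (fun x => (φ k).eval x - f x) 2 (volume.restrict (Set.Ici 0)))
      atTop (𝓝 0) := by
  let K : Submodule ℝ (Lp ℝ 2 (volume.restrict (Set.Ici (0 : ℝ)))) :=
    { carrier := Set.range fun φ : StepFunction => (φ.memLp_eval 2).toLp
      add_mem' := by
        rintro _ _ ⟨φ, rfl⟩ ⟨ψ, rfl⟩
        refine ⟨φ.add ψ, ?_⟩
        simp only [← MemLp.toLp_add]
        congr 1; ext x; exact φ.eval_add ψ x
      zero_mem' := by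
        refine ⟨StepFunction.smul 0 (StepFunction.single 0 0 le_rfl), ?_⟩
        simp only
        rw [← MemLp.toLp_zero (MemLp.zero (ε := ℝ))]
        congr 1; ext x; simp [StepFunction.eval_smul]
      smul_mem' := by
        rintro c _ ⟨φ, rfl⟩
        refine ⟨StepFunction.smul c φ, ?_⟩
        simp only [← MemLp.toLp_const_smul]
        congr 1; ext x; exact φ.eval_smul c x }
  -- Density by duality: a `g` orthogonal to every step function is orthogonal to each indicator of
  -- `(0, b]`, hence zero.
  have hK : K.topologicalClosure = ⊤ := by
    rw [Submodule.topologicalClosure_eq_top_iff, Submodule.eq_bot_iff]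
    intro g hg
    rw [Lp.eq_zero_iff_ae_eq_zero]
    refine ae_eq_zero_of_forall_setIntegral_Ioc_eq_zero (Lp.memLp g) fun b => ?_
    have h1 := (Submodule.mem_orthogonal K g).1 hg _
      ⟨StepFunction.single 0 b zero_le, rfl⟩
    rw [L2.inner_def] at h1
    have hs : Set.Ioc (0 : ℝ) b ⊆ Set.Ici 0 := fun x hx => hx.1.le
    rw [← Set.inter_eq_left.2 hs, ← Measure.restrict_restrict measurableSet_Ioc,
      ← integral_indicator measurableSet_Ioc]
    refine Eq.trans (integral_congr_ae ?_) h1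
    filter_upwards [((StepFunction.single 0 b zero_le).memLp_eval 2).coeFn_toLp] with x hx
    rw [hx, StepFunction.eval_single]
    by_cases hxb : x ∈ Set.Ioc (0 : ℝ) b <;> simp [hxb]
  have hmem : hf.toLp ∈ closure (K : Set (Lp ℝ 2 (volume.restrict (Set.Ici (0 : ℝ))))) := by
    rw [← Submodule.topologicalClosure_coe, hK]; trivial
  obtain ⟨u, hu, hlim⟩ := mem_closure_iff_seq_limit.1 hmem
  choose φ hφ using hu
  refine ⟨φ, ?_⟩
  have h2 : u = fun k => ((φ k).memLp_eval 2).toLp := funext fun k => (hφ k).symm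
  rw [h2] at hlim
  exact (Lp.tendsto_Lp_iff_tendsto_eLpNorm'' _ (fun k => (φ k).memLp_eval 2) _ hf).1 hlim

/-! ### Convergence in $L^2$. -/

theorem integral_sq_eq_toReal_eLpNorm_sq {α : Type*} {mα : MeasurableSpace α} {μ : Measure α}
    {f : α → ℝ} (hf : MemLp f 2 μ) : ∫ x, f x ^ 2 ∂μ = (eLpNorm f 2 μ).toReal ^ 2 := by
  have h : 0 ≤ ∫ x, f x ^ 2 ∂μ := integral_nonneg fun x => sq_nonneg _
  rw [hf.eLpNorm_eq_integral_rpow_norm (by simp) (by simp), ENNReal.toReal_ofReal (by positivity)]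
  simp only [ENNReal.toReal_ofNat, Real.rpow_ofNat, Real.norm_eq_abs, sq_abs]
  rw [← Real.rpow_natCast, ← Real.rpow_mul h]
  simp

theorem tendsto_integral_sq_of_tendsto_eLpNorm {α : Type*} {mα : MeasurableSpace α}
    {μ : Measure α} {f : ℕ → α → ℝ} {g : α → ℝ} (hf : ∀ n, MemLp (f n) 2 μ) (hg : MemLp g 2 μ)
    (h : Tendsto (fun n => eLpNorm (fun x => f n x - g x) 2 μ) atTop (𝓝 0)) :
    Tendsto (fun n => ∫ x, f n x ^ 2 ∂μ) atTop (𝓝 (∫ x, g x ^ 2 ∂μ)) := by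
  have h1 := ((Lp.tendsto_Lp_iff_tendsto_eLpNorm'' f hf g hg).2 h).norm
  simp only [Lp.norm_toLp] at h1
  simpa only [fun n => integral_sq_eq_toReal_eLpNorm_sq (hf n),
    integral_sq_eq_toReal_eLpNorm_sq hg] using h1.pow 2

theorem tendsto_eLpNorm_zero_of_sub {α : Type*} {mα : MeasurableSpace α}
    {μ : Measure α} {f g : ℕ → α → ℝ} {h : α → ℝ} (hf : ∀ n, AEStronglyMeasurable (f n) μ)
    (hg : ∀ n, AEStronglyMeasurable (g n) μ) (hh : AEStronglyMeasurable h μ)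
    (h1 : Tendsto (fun n => eLpNorm (fun x => f n x - g n x) 2 μ) atTop (𝓝 0))
    (h2 : Tendsto (fun n => eLpNorm (fun x => g n x - h x) 2 μ) atTop (𝓝 0)) :
    Tendsto (fun n => eLpNorm (fun x => f n x - h x) 2 μ) atTop (𝓝 0) := by
  have h3 := h1.add h2
  rw [add_zero] at h3
  refine tendsto_of_tendsto_of_tendsto_of_le_of_le tendsto_const_nhds h3 (fun _ => zero_le)
    fun n => ?_
  have h4 : (fun x => f n x - h x) = (fun x => f n x - g n x) + fun x => g n x - h x := by
    ext x; simp
  rw [h4]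
  exact eLpNorm_add_le ((hf n).sub (hg n)) ((hg n).sub hh) (by norm_num)

theorem tendsto_eLpNorm_sub_add {α : Type*} {mα : MeasurableSpace α}
    {μ : Measure α} {f f' : ℕ → α → ℝ} {g g' : α → ℝ} (hf : ∀ n, AEStronglyMeasurable (f n) μ)
    (hf' : ∀ n, AEStronglyMeasurable (f' n) μ) (hg : AEStronglyMeasurable g μ)
    (hg' : AEStronglyMeasurable g' μ)
    (h1 : Tendsto (fun n => eLpNorm (fun x => f n x - g x) 2 μ) atTop (𝓝 0))
    (h2 : Tendsto (fun n => eLpNorm (fun x => f' n x - g' x) 2 μ) atTop (𝓝 0)) :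
    Tendsto (fun n => eLpNorm (fun x => f n x + f' n x - (g x + g' x)) 2 μ) atTop (𝓝 0) := by
  have h3 := h1.add h2
  rw [add_zero] at h3
  refine tendsto_of_tendsto_of_tendsto_of_le_of_le tendsto_const_nhds h3 (fun _ => zero_le)
    fun n => ?_
  have h4 : (fun x => f n x + f' n x - (g x + g' x)) =
      (fun x => f n x - g x) + fun x => f' n x - g' x := by
    ext x; simp only [Pi.add_apply]; ring
  rw [h4]
  exact eLpNorm_add_le ((hf n).sub hg) ((hf' n).sub hg') (by norm_num)

theorem tendsto_eLpNorm_sub_const_mul {α : Type*} {mα : MeasurableSpace α}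
    {μ : Measure α} {f : ℕ → α → ℝ} {g : α → ℝ} (c : ℝ)
    (h1 : Tendsto (fun n => eLpNorm (fun x => f n x - g x) 2 μ) atTop (𝓝 0)) :
    Tendsto (fun n => eLpNorm (fun x => c * f n x - c * g x) 2 μ) atTop (𝓝 0) := by
  have h4 (n) : (fun x => c * f n x - c * g x) = c • fun x => f n x - g x := by
    ext x; simp [mul_sub]
  simp only [h4, eLpNorm_const_smul]
  simpa using ENNReal.Tendsto.const_mul h1 (Or.inr enorm_ne_top)

/-! ### Wiener integrals: linearity, existence, law. -/

section

variable {Ω : Type*} {mΩ : MeasurableSpace Ω} {P : Measure Ω} {B : ℝ≥0 → Ω → ℝ}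
  {f g : ℝ → ℝ} {I J : Ω → ℝ}

theorem IsWienerIntegral.congr_ae (hI : IsWienerIntegral B P f I) (hJ : Measurable J)
    (h : I =ᵐ[P] J) : IsWienerIntegral B P f J := by
  obtain ⟨-, φ, h1, h2⟩ := hI
  refine ⟨hJ, φ, h1, h2.congr fun k => eLpNorm_congr_ae ?_⟩
  filter_upwards [h] with ω hω
  rw [hω]

theorem IsWienerIntegral.const_mul (hI : IsWienerIntegral B P f I) (c : ℝ) :
    IsWienerIntegral B P (fun x => c * f x) fun ω => c * I ω := by
  obtain ⟨hm, φ, h1, h2⟩ := hI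
  refine ⟨hm.const_mul c, fun k => StepFunction.smul c (φ k), ?_, ?_⟩
  · simpa only [StepFunction.eval_smul] using tendsto_eLpNorm_sub_const_mul c h1
  · simpa only [StepFunction.integral_smul] using tendsto_eLpNorm_sub_const_mul c h2

theorem isWienerIntegral_zero : IsWienerIntegral B P (fun _ => 0) fun _ => 0 := by
  refine ⟨measurable_const, fun _ => StepFunction.smul 0 (StepFunction.single 0 0 le_rfl), ?_, ?_⟩
  · simp [StepFunction.eval_smul]
  · simp [StepFunction.integral_smul]

theorem isWienerIntegral_increment (hBm : ∀ t, Measurable (B t)) (a b : ℝ≥0) (h : a ≤ b) :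
    IsWienerIntegral B P ((Set.Ioc (a : ℝ) b).indicator fun _ => 1) fun ω => B b ω - B a ω := by
  refine ⟨(hBm b).sub (hBm a), fun _ => StepFunction.single a b h, ?_, ?_⟩
  · simp [StepFunction.eval_single]
  · simp [StepFunction.integral_single]

variable (hB : IsPreBrownianReal B P)

include hB

theorem memLp_stepIntegral (φ : StepFunction) : MemLp (φ.integral B) 2 P :=
  (hasGaussianLaw_stepIntegral hB φ).memLp_two

theorem eLpNorm_stepIntegral_sub (φ ψ : StepFunction) :
    eLpNorm (fun ω => φ.integral B ω - ψ.integral B ω) 2 P =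
      eLpNorm (fun x => φ.eval x - ψ.eval x) 2 (volume.restrict (Set.Ici 0)) := by
  have := eLpNorm_stepIntegral hB (φ.add (StepFunction.smul (-1) ψ))
  convert this using 2
  · ext ω; simp [StepFunction.integral_add, StepFunction.integral_smul, sub_eq_add_neg]
  · ext x; simp [StepFunction.eval_add, StepFunction.eval_smul, sub_eq_add_neg]

theorem hasLaw_stepIntegral (φ : StepFunction) :
    HasLaw (φ.integral B) (gaussianReal 0 (∫ x in Set.Ici (0 : ℝ), φ.eval x ^ 2).toNNReal) P := by
  have h := hasGaussianLaw_stepIntegral hB φ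
  refine ⟨h.aemeasurable, ?_⟩
  rw [h.map_eq_gaussianReal, integral_stepIntegral hB, variance_stepIntegral hB]

theorem IsWienerIntegral.add (hf : MemLp f 2 (volume.restrict (Set.Ici 0)))
    (hg : MemLp g 2 (volume.restrict (Set.Ici 0)))
    (hI : IsWienerIntegral B P f I) (hJ : IsWienerIntegral B P g J) :
    IsWienerIntegral B P (fun x => f x + g x) fun ω => I ω + J ω := by
  obtain ⟨hm, φ, h1, h2⟩ := hI
  obtain ⟨hm', φ', h1', h2'⟩ := hJ
  refine ⟨hm.add hm', fun k => (φ k).add (φ' k), ?_, ?_⟩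
  · simpa only [StepFunction.eval_add] using tendsto_eLpNorm_sub_add
      (fun n => ((φ n).memLp_eval 2).1) (fun n => ((φ' n).memLp_eval 2).1) hf.1 hg.1 h1 h1'
  · simpa only [StepFunction.integral_add] using tendsto_eLpNorm_sub_add
      (fun n => (memLp_stepIntegral hB (φ n)).1) (fun n => (memLp_stepIntegral hB (φ' n)).1)
      hm.aestronglyMeasurable hm'.aestronglyMeasurable h2 h2'

/-- Every sequence of step functions converging to the integrand computes the Wiener integral. -/
theorem IsWienerIntegral.tendsto_stepIntegral (hf : MemLp f 2 (volume.restrict (Set.Ici 0)))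
    (hI : IsWienerIntegral B P f I) {ψ : ℕ → StepFunction}
    (hψ : Tendsto (fun k => eLpNorm (fun x => (ψ k).eval x - f x) 2
      (volume.restrict (Set.Ici 0))) atTop (𝓝 0)) :
    Tendsto (fun k => eLpNorm (fun ω => (ψ k).integral B ω - I ω) 2 P) atTop (𝓝 0) := by
  obtain ⟨hm, φ, h1, h2⟩ := hI
  refine tendsto_eLpNorm_zero_of_sub (fun n => (memLp_stepIntegral hB (ψ n)).1)
    (fun n => (memLp_stepIntegral hB (φ n)).1) hm.aestronglyMeasurable ?_ h2
  simp only [eLpNorm_stepIntegral_sub hB]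
  refine (tendsto_eLpNorm_sub_add (fun n => ((ψ n).memLp_eval 2).1)
    (fun n => ((φ n).memLp_eval 2).1.const_mul (-1)) hf.1 (hf.1.const_mul (-1)) hψ
    (tendsto_eLpNorm_sub_const_mul (-1) h1)).congr fun n => ?_
  congr 1
  ext x
  ring

theorem exists_isWienerIntegral (hf : MemLp f 2 (volume.restrict (Set.Ici 0))) :
    ∃ I, IsWienerIntegral B P f I := by
  obtain ⟨φ, hφ⟩ := exists_stepFunction_tendsto hf
  have hc : CauchySeq fun k => ((φ k).memLp_eval 2).toLp :=
    ((Lp.tendsto_Lp_iff_tendsto_eLpNorm'' _ (fun k => (φ k).memLp_eval 2) _ hf).2 hφ).cauchySeq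
  -- The isometry carries the Cauchy property from the integrands to their elementary integrals.
  have hc' : CauchySeq fun k => (memLp_stepIntegral hB (φ k)).toLp := by
    rw [Metric.cauchySeq_iff] at hc ⊢
    refine fun ε hε => (hc ε hε).imp fun N hN m hm n hn => ?_
    have := hN m hm n hn
    rw [Lp.dist_def] at this ⊢
    rw [eLpNorm_congr_ae ((MemLp.coeFn_toLp _).sub (MemLp.coeFn_toLp _))] at this ⊢
    exact (eLpNorm_stepIntegral_sub hB _ _).symm ▸ this
  obtain ⟨I, hI⟩ := cauchySeq_tendsto_of_complete hc'
  have hIm := (Lp.aestronglyMeasurable I).aemeasurable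
  -- A Wiener integral has to be measurable outright, so a measurable representative of the limit
  -- class is taken.
  refine ⟨hIm.mk, hIm.measurable_mk, φ, hφ, ?_⟩
  have hI2 := (memLp_congr_ae hIm.ae_eq_mk).1 (Lp.memLp I)
  refine (Lp.tendsto_Lp_iff_tendsto_eLpNorm'' _ (fun k => memLp_stepIntegral hB (φ k)) _ hI2).1 ?_
  convert hI
  rw [Lp.ext_iff]
  exact hI2.coeFn_toLp.trans hIm.ae_eq_mk.symm

/-- The Wiener integral of `f` is centered Gaussian with variance `∫ f²`. -/
theorem IsWienerIntegral.hasLaw (hf : MemLp f 2 (volume.restrict (Set.Ici 0)))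
    (hI : IsWienerIntegral B P f I) :
    HasLaw I (gaussianReal 0 (∫ x in Set.Ici (0 : ℝ), f x ^ 2).toNNReal) P := by
  have := hB.isGaussianProcess.isProbabilityMeasure
  obtain ⟨hm, φ, h1, h2⟩ := hI
  refine ⟨hm.aemeasurable, ?_⟩
  have hmeas := tendstoInMeasure_of_tendsto_eLpNorm (by norm_num)
    (fun n => (memLp_stepIntegral hB (φ n)).1) hm.aestronglyMeasurable h2
  have hd := (hmeas.tendstoInDistribution fun n => (memLp_stepIntegral hB (φ n)).1.aemeasurable)
  have hv := tendsto_integral_sq_of_tendsto_eLpNorm (fun n => (φ n).memLp_eval 2) hf h1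
  have := Measure.isProbabilityMeasure_map hm.aemeasurable (μ := P)
  -- Convergence in distribution sends the characteristic functions of the elementary integrals to
  -- that of `I`; convergence of the variances sends them to the Gaussian one.
  refine Measure.ext_of_charFun (funext fun t => ?_)
  refine tendsto_nhds_unique (ProbabilityMeasure.tendsto_iff_tendsto_charFun.1 hd.tendsto t) ?_
  simp only [ProbabilityMeasure.coe_mk, (hasLaw_stepIntegral hB _).map_eq, charFun_gaussianReal]
  refine Tendsto.cexp ?_
  refine tendsto_const_nhds.sub (Tendsto.div_const (Tendsto.mul_const _ ?_) _)
  exact (Complex.continuous_ofReal.tendsto _).comp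
    ((NNReal.continuous_coe.tendsto _).comp ((continuous_real_toNNReal.tendsto _).comp hv))

end

/-! ### Measurability of limits in an augmented σ-algebra. -/

theorem measurable_limUnder_real {Ω : Type*} {F : MeasurableSpace Ω} {X : ℕ → Ω → ℝ}
    (hX : ∀ n, Measurable (X n)) : Measurable fun ω => limUnder atTop fun n => X n ω :=
  (StronglyMeasurable.limUnder fun n => (hX n).stronglyMeasurable).measurable

/-- The augmentation contains only null sets that are already events. Measurability of `I` for `mΩ`
ensures that the exceptional sets are of this kind. -/
theorem measurable_of_ae_eq {Ω : Type*} {F mΩ : MeasurableSpace Ω} {P : Measure Ω} {I J : Ω → ℝ}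
    (hF : nullEvents P ≤ F) (hFm : F ≤ mΩ)
    (hI : Measurable I) (hJ : Measurable[F] J) (h : I =ᵐ[P] J) : Measurable[F] I := by
  intro A hA
  have hJ' : Measurable J := hJ.mono hFm le_rfl
  set N := {ω | I ω ≠ J ω} with hN
  have hNm : MeasurableSet N := (measurableSet_eq_fun hI hJ').compl
  have hN0 : P N = 0 := h
  have hnull {A : Set Ω} (h1 : MeasurableSet A) (h2 : P A = 0) : MeasurableSet[F] A :=
    hF _ (MeasurableSpace.measurableSet_generateFrom ⟨h1, h2⟩)
  have : I ⁻¹' A = (J ⁻¹' A \ N) ∪ (I ⁻¹' A ∩ N) := by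
    ext ω
    simp only [hN, Set.mem_preimage, Set.mem_union, Set.mem_sdiff, Set.mem_ofPred_eq, Set.mem_inter_iff]
    by_cases hω : I ω = J ω <;> simp [hω]
  rw [this]
  exact (MeasurableSet.diff (hJ hA) (hnull hNm hN0)).union
    (hnull ((hI hA).inter hNm) (measure_mono_null Set.inter_subset_right hN0))

/-- A subsequence of the elementary integrals converges almost surely, and its limit is
`F`-measurable; the null events absorb the difference from `I`. -/
theorem IsWienerIntegral.measurable_of_tendsto {Ω : Type*} {F mΩ : MeasurableSpace Ω} {P : Measure Ω}
    {B : ℝ≥0 → Ω → ℝ} {f : ℝ → ℝ} {I : Ω → ℝ} (hB : IsPreBrownianReal B P) (hF : nullEvents P ≤ F)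
    (hFm : F ≤ mΩ) (hf : MemLp f 2 (volume.restrict (Set.Ici 0))) (hI : IsWienerIntegral B P f I)
    {φ : ℕ → StepFunction} (hφ : ∀ k, Measurable[F] ((φ k).integral B))
    (h : Tendsto (fun k => eLpNorm (fun x => (φ k).eval x - f x) 2
      (volume.restrict (Set.Ici 0))) atTop (𝓝 0)) : Measurable[F] I := by
  have hlim := hI.tendsto_stepIntegral hB hf h
  obtain ⟨ns, -, hns⟩ := (tendstoInMeasure_of_tendsto_eLpNorm (by norm_num)
    (fun n => (memLp_stepIntegral hB (φ n)).1) hI.1.aestronglyMeasurable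
    hlim).exists_seq_tendsto_ae
  refine measurable_of_ae_eq hF hFm hI.1
    (J := fun ω => limUnder atTop fun k => (φ (ns k)).integral B ω) ?_ ?_
  · exact measurable_limUnder_real fun k => hφ (ns k)
  · filter_upwards [hns] with ω hω
    exact hω.limUnder_eq.symm

/-! ### Covariance, joint Gaussianity and independence of Wiener integrals. -/

section

variable {Ω : Type*} {mΩ : MeasurableSpace Ω} {P : Measure Ω} {B : ℝ≥0 → Ω → ℝ}
  {f g : ℝ → ℝ} {I J : Ω → ℝ} (hB : IsPreBrownianReal B P)

include hB

theorem IsWienerIntegral.variance_eq (hf : MemLp f 2 (volume.restrict (Set.Ici 0)))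
    (hI : IsWienerIntegral B P f I) : Var[I; P] = ∫ x in Set.Ici (0 : ℝ), f x ^ 2 := by
  rw [(hI.hasLaw hB hf).variance_eq, variance_id_gaussianReal,
    Real.coe_toNNReal _ (integral_nonneg fun x => sq_nonneg _)]

theorem IsWienerIntegral.memLp (hf : MemLp f 2 (volume.restrict (Set.Ici 0)))
    (hI : IsWienerIntegral B P f I) : MemLp I 2 P :=
  (hI.hasLaw hB hf).hasGaussianLaw.memLp_two

/-- Polarization of the variance formula, applied to `f`, `g` and `f + g`. -/
theorem IsWienerIntegral.covariance_eq (hf : MemLp f 2 (volume.restrict (Set.Ici 0)))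
    (hg : MemLp g 2 (volume.restrict (Set.Ici 0)))
    (hI : IsWienerIntegral B P f I) (hJ : IsWienerIntegral B P g J) :
    cov[I, J; P] = ∫ x in Set.Ici (0 : ℝ), f x * g x := by
  have := hB.isGaussianProcess.isProbabilityMeasure
  have h1 := variance_add (hI.memLp hB hf) (hJ.memLp hB hg)
  have h2 := (hI.add hB hf hg hJ).variance_eq hB (hf.add hg)
  have h3 : ∫ x in Set.Ici (0 : ℝ), (f x + g x) ^ 2 = (∫ x in Set.Ici (0 : ℝ), f x ^ 2) +
      2 * (∫ x in Set.Ici (0 : ℝ), f x * g x) + ∫ x in Set.Ici (0 : ℝ), g x ^ 2 := by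
    have h4 : Integrable (fun x => f x * g x) (volume.restrict (Set.Ici 0)) :=
      hf.integrable_mul hg
    rw [← integral_const_mul, ← integral_add hf.integrable_sq (h4.const_mul 2),
      ← integral_add (f := fun x => f x ^ 2 + 2 * (f x * g x))
        (hf.integrable_sq.add (h4.const_mul 2)) hg.integrable_sq]
    congr 1; ext x; ring
  rw [hI.variance_eq hB hf, hJ.variance_eq hB hg] at h1
  change Var[I + J; P] = ∫ x in Set.Ici (0 : ℝ), (f x + g x) ^ 2 at h2
  linarith

theorem isWienerIntegral_sum {ι : Type*} {F : ι → ℝ → ℝ} {X : ι → Ω → ℝ}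
    (hF : ∀ i, MemLp (F i) 2 (volume.restrict (Set.Ici 0)))
    (hX : ∀ i, IsWienerIntegral B P (F i) (X i)) (c : ι → ℝ) (s : Finset ι) :
    IsWienerIntegral B P (fun x => ∑ i ∈ s, c i * F i x) fun ω => ∑ i ∈ s, c i * X i ω := by
  classical
  induction s using Finset.induction_on with
  | empty => simpa using isWienerIntegral_zero
  | insert i s hi ih =>
    simp only [Finset.sum_insert hi]
    exact ((hX i).const_mul (c i)).add hB ((hF i).const_mul _)
      (memLp_finsetSum _ fun j _ => (hF j).const_mul _) ih

/-- A family of Wiener integrals is a Gaussian process. -/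
theorem isGaussianProcess_of_isWienerIntegral {ι : Type*} {F : ι → ℝ → ℝ} {X : ι → Ω → ℝ}
    (hF : ∀ i, MemLp (F i) 2 (volume.restrict (Set.Ici 0)))
    (hX : ∀ i, IsWienerIntegral B P (F i) (X i)) : IsGaussianProcess X P where
  hasGaussianLaw T := by
    classical
    have hm : Measurable fun ω => T.restrict (X · ω) :=
      measurable_pi_lambda _ fun i => (hX i).1
    refine ⟨⟨fun L => ?_⟩⟩
    have hL : L ∘ (fun ω => T.restrict (X · ω)) =
        fun ω => ∑ i : T, L (Pi.single i 1) * X i ω := by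
      ext ω
      have := L.toLinearMap.pi_apply_eq_sum_univ (T.restrict (X · ω))
      simp only [ContinuousLinearMap.coe_coe] at this
      simp only [Function.comp_apply, this, smul_eq_mul, Finset.restrict, mul_comm]
      refine Finset.sum_congr rfl fun i _ => ?_
      congr 2
      ext j
      simp [Pi.single_apply, eq_comm]
    -- By linearity, every linear functional of the finite vector is again a Wiener integral, hence
    -- Gaussian.
    have hw := isWienerIntegral_sum hB (fun i : T => hF i) (fun i : T => hX i)
      (fun i => L (Pi.single i 1)) Finset.univ
    have hG := (hw.hasLaw hB
      (memLp_finsetSum _ fun (j : T) _ => (hF j).const_mul _)).hasGaussianLaw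
    rw [← hL] at hG
    rw [Measure.map_map L.continuous.measurable hm, hG.map_eq_gaussianReal,
      integral_map hm.aemeasurable L.continuous.aestronglyMeasurable,
      variance_map L.continuous.measurable.aemeasurable hm.aemeasurable]
    rfl

theorem isWienerIntegral_eval (hBm : ∀ t, Measurable (B t)) (v : ℝ≥0) :
    IsWienerIntegral B P ((Set.Ioc (0 : ℝ) v).indicator fun _ => 1) (B v) := by
  refine (isWienerIntegral_increment hBm 0 v zero_le).congr_ae (hBm v) ?_
  filter_upwards [hB.eval_zero_ae_eq_zero] with ω hω
  rw [hω, sub_zero]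

-- Every set in the join agrees almost everywhere with a set of `m₂`, and independence only sees
-- probabilities.
omit hB in
theorem indep_sup_nullEvents {m₁ m₂ : MeasurableSpace Ω} (h : Indep m₁ m₂ P) :
    Indep m₁ (m₂ ⊔ nullEvents P) P := by
  rw [Indep_iff] at h ⊢
  intro t₁ t₂ h₁ h₂
  have hle : m₂ ⊔ nullEvents P ≤ eventuallyMeasurableSpace m₂ (ae P) := by
    refine sup_le le_eventuallyMeasurableSpace (MeasurableSpace.generateFrom_le fun A hA => ?_)
    exact ⟨∅, MeasurableSet.empty, ae_eq_empty.2 hA.2⟩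
  obtain ⟨t, ht, htt⟩ := hle _ h₂
  rw [measure_congr htt, ← h _ _ h₁ ht]
  exact measure_congr ((ae_eq_refl t₁).inter htt)

/-- The Wiener integral of a function which is orthogonal to the indicator functions of `(0, v]`,
`v ∈ S`, is independent of `(B v)_{v ∈ S}`. -/
theorem IsWienerIntegral.indep (hBm : ∀ t, Measurable (B t))
    (hf : MemLp f 2 (volume.restrict (Set.Ici 0))) (hI : IsWienerIntegral B P f I)
    (S : Set ℝ≥0) (hS : ∀ v ∈ S, ∫ x in Set.Ioc (0 : ℝ) v, f x = 0) :
    Indep (MeasurableSpace.comap I inferInstance)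
      ((⨆ v ∈ S, MeasurableSpace.comap (B v) inferInstance) ⊔ nullEvents P) P := by
  refine indep_sup_nullEvents ?_
  -- `I` and all `B v` form one Gaussian process, so vanishing covariances yield independence of the
  -- two blocks.
  have hG : IsGaussianProcess (Sum.elim (fun _ : Unit => I) fun v : S => B v) P := by
    refine isGaussianProcess_of_isWienerIntegral hB
      (F := Sum.elim (fun _ : Unit => f) fun v : S => (Set.Ioc (0 : ℝ) v).indicator fun _ => 1) ?_ ?_
    · rintro (_ | v)
      · exact hf
      · exact StepFunction.memLp_indicator_Ioc _ _ 2
    · rintro (_ | v)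
      · exact hI
      · exact isWienerIntegral_eval hB hBm v
  have hind := hG.indepFun_of_covariance_eq_zero (fun _ => hI.1.aemeasurable)
    (fun v => (hBm v).aemeasurable) fun _ v => by
      rw [hI.covariance_eq hB hf (StepFunction.memLp_indicator_Ioc _ _ 2)
        (isWienerIntegral_eval hB hBm v)]
      refine Eq.trans ?_ (hS v v.2)
      have hs : Set.Ioc (0 : ℝ) v ⊆ Set.Ici 0 := fun x hx => hx.1.le
      rw [← Set.inter_eq_left.2 hs, ← Measure.restrict_restrict measurableSet_Ioc,
        ← integral_indicator measurableSet_Ioc, Set.inter_eq_left.2 hs]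
      congr 1; ext x
      by_cases hx : x ∈ Set.Ioc (0 : ℝ) v <;> simp [hx]
  rw [IndepFun_iff_Indep] at hind
  refine indep_of_indep_of_le_left (indep_of_indep_of_le_right hind ?_) ?_
  · refine iSup₂_le fun v hv => ?_
    rintro _ ⟨A, hA, rfl⟩
    exact ⟨_, measurable_pi_apply (⟨v, hv⟩ : S) hA, rfl⟩
  · rintro _ ⟨A, hA, rfl⟩
    exact ⟨_, measurable_pi_apply () hA, rfl⟩

omit hB in
theorem measurable_stepIntegral {F : MeasurableSpace Ω} (φ : StepFunction)
    (h : ∀ i, Measurable[F] (B (φ.left i)) ∧ Measurable[F] (B (φ.right i))) :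
    Measurable[F] (φ.integral B) := by
  unfold StepFunction.integral
  exact Finset.measurable_fun_sum _ fun i _ => ((h i).2.sub (h i).1).const_mul _

omit hB in
theorem measurable_eval_naturalPastFuture (hBm : ∀ t, Measurable (B t)) {s t v : ℝ≥0}
    (hv : v ≤ s ∨ t ≤ v) : Measurable[(naturalPastFuture B hBm P).seq s t] (B v) := by
  refine Measurable.mono (comap_measurable (B v)) ?_ le_rfl
  exact le_sup_of_le_left
    (le_iSup₂_of_le (f := fun v (_ : v ∈ {v : ℝ≥0 | v ≤ s ∨ t ≤ v}) =>
      MeasurableSpace.comap (B v) inferInstance) v hv le_rfl)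

theorem isWienerIntegral_wienerIntegral (hf : MemLp f 2 (volume.restrict (Set.Ici 0))) :
    IsWienerIntegral B P f (wienerIntegral B P f) := by
  have h := exists_isWienerIntegral hB hf
  rw [wienerIntegral, dif_pos h]
  exact h.choose_spec

theorem isWienerIntegral_pastIntegral (hf : MemLp f 2 (volume.restrict (Set.Ici 0))) (s : ℝ≥0) :
    IsWienerIntegral B P ((Set.Ioc (0 : ℝ) s).indicator f) (pastIntegral B P f s) :=
  isWienerIntegral_wienerIntegral hB (hf.indicator measurableSet_Ioc)

theorem isWienerIntegral_futureIntegral (hf : MemLp f 2 (volume.restrict (Set.Ici 0))) (t : ℝ≥0) :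
    IsWienerIntegral B P ((Set.Ioi (t : ℝ)).indicator f) (futureIntegral B P f t) :=
  isWienerIntegral_wienerIntegral hB (hf.indicator measurableSet_Ioi)

-- The limit already vanishes off `A`, so truncating the approximants to `A` cannot increase their
-- distance to it.
omit hB in
theorem tendsto_eLpNorm_indicator {φ : ℕ → ℝ → ℝ} {μ : Measure ℝ} {A : Set ℝ}
    (h : Tendsto (fun k => eLpNorm (fun x => φ k x - A.indicator f x) 2 μ) atTop (𝓝 0)) :
    Tendsto (fun k => eLpNorm (fun x => A.indicator (φ k) x - A.indicator f x) 2 μ)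
      atTop (𝓝 0) := by
  refine tendsto_of_tendsto_of_tendsto_of_le_of_le tendsto_const_nhds h (fun _ => zero_le)
    fun k => eLpNorm_mono fun x => ?_
  by_cases hx : x ∈ A <;> simp [hx]

theorem measurable_pastIntegral (hBm : ∀ t, Measurable (B t))
    (hf : MemLp f 2 (volume.restrict (Set.Ici 0))) {s t : ℝ≥0} (hst : s < t) :
    Measurable[(naturalPastFuture B hBm P).seq s t] (pastIntegral B P f s) := by
  have hI := isWienerIntegral_pastIntegral hB hf s
  obtain ⟨-, φ, hφ, -⟩ := id hI
  refine hI.measurable_of_tendsto hB le_sup_right ((naturalPastFuture B hBm P).le s t hst)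
    (hf.indicator measurableSet_Ioc) (φ := fun k => (φ k).clamp 0 s) (fun k => ?_) ?_
  · exact measurable_stepIntegral _ fun i =>
      ⟨measurable_eval_naturalPastFuture hBm (Or.inl inf_le_right),
        measurable_eval_naturalPastFuture hBm (Or.inl inf_le_right)⟩
  · simp only [StepFunction.eval_clamp]
    exact tendsto_eLpNorm_indicator hφ

theorem measurable_futureIntegral (hBm : ∀ t, Measurable (B t))
    (hf : MemLp f 2 (volume.restrict (Set.Ici 0))) {s t : ℝ≥0} (hst : s < t) :
    Measurable[(naturalPastFuture B hBm P).seq s t] (futureIntegral B P f t) := by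
  have hI := isWienerIntegral_futureIntegral hB hf t
  obtain ⟨-, φ, hφ, -⟩ := id hI
  refine hI.measurable_of_tendsto hB le_sup_right ((naturalPastFuture B hBm P).le s t hst)
    (hf.indicator measurableSet_Ioi) (φ := fun k => (φ k).clampLeft t) (fun k => ?_) ?_
  · exact measurable_stepIntegral _ fun i =>
      ⟨measurable_eval_naturalPastFuture hBm (Or.inr le_sup_right),
        measurable_eval_naturalPastFuture hBm (Or.inr le_sup_right)⟩
  · simp only [StepFunction.eval_clampLeft]
    exact tendsto_eLpNorm_indicator hφ

theorem measurable_linearProcess (hBm : ∀ t, Measurable (B t)) {fm fp : ℝ → ℝ} (C : ℝ)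
    (hm : MemLp fm 2 (volume.restrict (Set.Ici 0))) (hp : MemLp fp 2 (volume.restrict (Set.Ici 0)))
    {s t : ℝ≥0} (hst : s < t) :
    Measurable[(naturalPastFuture B hBm P).seq s t] (linearProcess B P fm fp C s t) := by
  refine Measurable.add (Measurable.add (measurable_pastIntegral hB hBm hm hst)
    (measurable_futureIntegral hB hBm hp hst)) ?_
  exact (((measurable_eval_naturalPastFuture hBm (Or.inr le_rfl)).sub
    (measurable_eval_naturalPastFuture hBm (Or.inl le_rfl))).div_const _).mul_const _

end

/-! ### The integrand of $M$: primitive and square integral. -/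

/-- The integrand of `linearProcess`, seen as a single Wiener integral. -/
noncomputable def harnessIntegrand (fm fp : ℝ → ℝ) (C : ℝ) (s t : ℝ≥0) (x : ℝ) : ℝ :=
  (Set.Ioc (0 : ℝ) s).indicator fm x + (Set.Ioi (t : ℝ)).indicator fp x
    + harnessCoeff fm fp C s t / ((t : ℝ) - s)
      * (Set.Ioc (s : ℝ) t).indicator (fun _ => 1) x

section

variable {fm fp : ℝ → ℝ} {C : ℝ}

theorem memLp_harnessIntegrand (hm : MemLp fm 2 (volume.restrict (Set.Ici 0)))
    (hp : MemLp fp 2 (volume.restrict (Set.Ici 0))) (s t : ℝ≥0) :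
    MemLp (harnessIntegrand fm fp C s t) 2 (volume.restrict (Set.Ici 0)) :=
  ((hm.indicator measurableSet_Ioc).add (hp.indicator measurableSet_Ioi)).add
    ((StepFunction.memLp_indicator_Ioc _ _ 2).const_mul _)

theorem integrable_indicator_Ioc (a b : ℝ) :
    Integrable ((Set.Ioc a b).indicator fun _ => (1 : ℝ)) :=
  (integrable_indicator_iff measurableSet_Ioc).2 (integrableOn_const (by simp))

theorem setIntegral_harnessIntegrand_of_le {s t v : ℝ≥0} (hst : s < t) (hv : v ≤ s) :
    ∫ x in Set.Ioc (0 : ℝ) v, harnessIntegrand fm fp C s t x = ∫ x in Set.Ioc (0 : ℝ) v, fm x := by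
  have h1 := NNReal.coe_le_coe.2 hv
  have h2 := NNReal.coe_lt_coe.2 hst
  refine setIntegral_congr_fun measurableSet_Ioc fun x hx => ?_
  have h3 : x ∈ Set.Ioc (0 : ℝ) s := ⟨hx.1, hx.2.trans h1⟩
  have h4 : x ∉ Set.Ioi (t : ℝ) := fun h => by have := h3.2; have := Set.mem_Ioi.1 h; linarith
  have h5 : x ∉ Set.Ioc (s : ℝ) t := fun h => by have := h3.2; have := h.1; linarith
  simp [harnessIntegrand, h3, h4, h5]

/-- The plateau on `(s, t]` has total mass `harnessCoeff`, which cancels the mass of `fm` on `(0,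
s]` and leaves a value free of `s` and `t`. This is the reason for the form of `harnessCoeff`. -/
theorem setIntegral_harnessIntegrand_of_ge (hm1 : IntegrableOn fm (Set.Ici 0))
    (hp1 : IntegrableOn fp (Set.Ici 0)) {s t v : ℝ≥0} (hst : s < t) (hv : t ≤ v) :
    ∫ x in Set.Ioc (0 : ℝ) v, harnessIntegrand fm fp C s t x
      = C - ∫ x in Set.Ioi (v : ℝ), fp x := by
  have h0 := s.coe_nonneg
  have h0' := t.coe_nonneg
  have h1 := NNReal.coe_le_coe.2 hv
  have h2 := NNReal.coe_lt_coe.2 hst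
  have hsub : Set.Ioc (0 : ℝ) v ⊆ Set.Ici 0 := fun x hx => hx.1.le
  have i1 : IntegrableOn ((Set.Ioc (0 : ℝ) s).indicator fm) (Set.Ioc (0 : ℝ) v) :=
    (hm1.mono_set hsub).indicator measurableSet_Ioc
  have i2 : IntegrableOn ((Set.Ioi (t : ℝ)).indicator fp) (Set.Ioc (0 : ℝ) v) :=
    (hp1.mono_set hsub).indicator measurableSet_Ioi
  have i3 : IntegrableOn (fun x => harnessCoeff fm fp C s t / ((t : ℝ) - s)
      * (Set.Ioc (s : ℝ) t).indicator (fun _ => 1) x) (Set.Ioc (0 : ℝ) v) :=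
    (integrable_indicator_Ioc s t).integrableOn.const_mul _
  have i12 := i1.add i2
  have e1 : Set.Ioc (0 : ℝ) v ∩ Set.Ioc (0 : ℝ) s = Set.Ioc (0 : ℝ) s := by
    ext x; simp only [Set.mem_inter_iff, Set.mem_Ioc]; grind
  have e2 : Set.Ioc (0 : ℝ) v ∩ Set.Ioi (t : ℝ) = Set.Ioc (t : ℝ) v := by
    ext x; simp only [Set.mem_inter_iff, Set.mem_Ioc, Set.mem_Ioi]; grind
  have e3 : Set.Ioc (0 : ℝ) v ∩ Set.Ioc (s : ℝ) t = Set.Ioc (s : ℝ) t := by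
    ext x; simp only [Set.mem_inter_iff, Set.mem_Ioc]; grind
  have h3 : ∫ x in Set.Ioi (t : ℝ), fp x
      = (∫ x in Set.Ioc (t : ℝ) v, fp x) + ∫ x in Set.Ioi (v : ℝ), fp x := by
    rw [← setIntegral_union Set.Ioc_disjoint_Ioi_same measurableSet_Ioi
      (hp1.mono_set fun x hx => h0'.trans hx.1.le)
      (hp1.mono_set fun x hx => h0'.trans (h1.trans (Set.mem_Ioi.1 hx).le)),
      Set.Ioc_union_Ioi_eq_Ioi h1]
  have h4 : (t : ℝ) - s ≠ 0 := (sub_pos.2 h2).ne'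
  unfold harnessIntegrand
  rw [integral_add (f := fun x => (Set.Ioc (0 : ℝ) s).indicator fm x
    + (Set.Ioi (t : ℝ)).indicator fp x) i12 i3, integral_add i1 i2, integral_const_mul,
    setIntegral_indicator measurableSet_Ioc, setIntegral_indicator measurableSet_Ioi,
    setIntegral_indicator measurableSet_Ioc, e1, e2, e3]
  simp only [integral_const, MeasurableSet.univ, measureReal_restrict_apply, Set.univ_inter,
    Real.volume_real_Ioc, smul_eq_mul, mul_one, max_eq_left (sub_pos.2 h2).le]
  rw [div_mul_cancel₀ _ h4, harnessCoeff, h3, intervalIntegral.integral_of_le h0]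
  ring

/-- The three pieces have disjoint supports, so there are no cross terms. The result is twice the
compensator in `exponentialProcess`. -/
theorem integral_harnessIntegrand_sq (hm2 : MemLp fm 2 (volume.restrict (Set.Ici 0)))
    (hp2 : MemLp fp 2 (volume.restrict (Set.Ici 0))) {s t : ℝ≥0} (hst : s < t) :
    ∫ x in Set.Ici (0 : ℝ), harnessIntegrand fm fp C s t x ^ 2 =
      (∫ u in (0 : ℝ)..s, fm u ^ 2) + (∫ u in Set.Ioi (t : ℝ), fp u ^ 2)
        + 1 / ((t : ℝ) - s) * harnessCoeff fm fp C s t ^ 2 := by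
  have h0 := s.coe_nonneg
  have h0' := t.coe_nonneg
  have h2 := NNReal.coe_lt_coe.2 hst
  have h4 : (t : ℝ) - s ≠ 0 := (sub_pos.2 h2).ne'
  have e1 : Set.Ici (0 : ℝ) ∩ Set.Ioc (0 : ℝ) s = Set.Ioc (0 : ℝ) s := by
    ext x; simp only [Set.mem_inter_iff, Set.mem_Ioc, Set.mem_Ici]; grind
  have e2 : Set.Ici (0 : ℝ) ∩ Set.Ioi (t : ℝ) = Set.Ioi (t : ℝ) := by
    ext x; simp only [Set.mem_inter_iff, Set.mem_Ici, Set.mem_Ioi]; grind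
  have e3 : Set.Ici (0 : ℝ) ∩ Set.Ioc (s : ℝ) t = Set.Ioc (s : ℝ) t := by
    ext x; simp only [Set.mem_inter_iff, Set.mem_Ioc, Set.mem_Ici]; grind
  have i1 : IntegrableOn ((Set.Ioc (0 : ℝ) s).indicator fun x => fm x ^ 2) (Set.Ici (0 : ℝ)) :=
    hm2.integrable_sq.indicator measurableSet_Ioc
  have i2 : IntegrableOn ((Set.Ioi (t : ℝ)).indicator fun x => fp x ^ 2) (Set.Ici (0 : ℝ)) :=
    hp2.integrable_sq.indicator measurableSet_Ioi
  have i3 : IntegrableOn (fun x => (harnessCoeff fm fp C s t / ((t : ℝ) - s)) ^ 2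
      * (Set.Ioc (s : ℝ) t).indicator (fun _ => 1) x) (Set.Ici (0 : ℝ)) :=
    (integrable_indicator_Ioc s t).integrableOn.const_mul _
  have i12 := i1.add i2
  have key : ∀ x, harnessIntegrand fm fp C s t x ^ 2 =
      (Set.Ioc (0 : ℝ) s).indicator (fun x => fm x ^ 2) x
        + (Set.Ioi (t : ℝ)).indicator (fun x => fp x ^ 2) x
        + (harnessCoeff fm fp C s t / ((t : ℝ) - s)) ^ 2
          * (Set.Ioc (s : ℝ) t).indicator (fun _ => 1) x := by
    intro x
    simp only [harnessIntegrand, Set.indicator_apply, Set.mem_Ioc, Set.mem_Ioi]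
    rcases le_or_gt x s with hx | hx
    · rw [if_neg (c := (t : ℝ) < x) (by linarith), if_neg (c := (t : ℝ) < x) (by linarith),
        if_neg (c := (s : ℝ) < x ∧ x ≤ t) (by rintro ⟨h, -⟩; linarith)]
      split_ifs <;> ring
    · rw [if_neg (c := 0 < x ∧ x ≤ (s : ℝ)) (by rintro ⟨-, h⟩; linarith),
        if_neg (c := 0 < x ∧ x ≤ (s : ℝ)) (by rintro ⟨-, h⟩; linarith)]
      rcases le_or_gt x t with hx' | hx'
      · rw [if_neg (c := (t : ℝ) < x) (by linarith), if_neg (c := (t : ℝ) < x) (by linarith),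
          if_pos ⟨hx, hx'⟩]
        ring
      · rw [if_neg (c := (s : ℝ) < x ∧ x ≤ t) (by rintro ⟨-, h⟩; linarith), if_pos hx', if_pos hx']
        ring
  simp only [key]
  rw [integral_add (f := fun x => (Set.Ioc (0 : ℝ) s).indicator (fun x => fm x ^ 2) x
    + (Set.Ioi (t : ℝ)).indicator (fun x => fp x ^ 2) x) i12 i3, integral_add i1 i2,
    integral_const_mul,
    setIntegral_indicator measurableSet_Ioc, setIntegral_indicator measurableSet_Ioi,
    setIntegral_indicator measurableSet_Ioc, e1, e2, e3]
  simp only [integral_const, MeasurableSet.univ, measureReal_restrict_apply, Set.univ_inter,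
    Real.volume_real_Ioc, smul_eq_mul, mul_one, max_eq_left (sub_pos.2 h2).le]
  rw [intervalIntegral.integral_of_le h0]
  field_simp

end

/-! ### Gaussian exponential moments and conditioning with independent terms. -/

section

variable {Ω : Type*} {mΩ : MeasurableSpace Ω} {P : Measure Ω}

theorem integrable_exp_of_hasLaw_gaussianReal {X : Ω → ℝ} {μ : ℝ} {v : ℝ≥0}
    (hX : HasLaw X (gaussianReal μ v) P) : Integrable (fun ω => Real.exp (X ω)) P := by
  have h := integrable_exp_mul_gaussianReal (μ := μ) (v := v) 1
  rw [← hX.map_eq, integrable_map_measure (by fun_prop) hX.aemeasurable] at h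
  simpa [Function.comp_def] using h

theorem integral_exp_of_hasLaw_gaussianReal {X : Ω → ℝ} {μ : ℝ} {v : ℝ≥0}
    (hX : HasLaw X (gaussianReal μ v) P) : ∫ ω, Real.exp (X ω) ∂P = Real.exp (μ + v / 2) := by
  simpa [mgf] using mgf_gaussianReal hX.map_eq 1

end

section

variable {Ω : Type*} {m mΩ : MeasurableSpace Ω} {P : Measure Ω} [IsProbabilityMeasure P]
  {X Y : Ω → ℝ}

theorem condExp_add_of_indep (hm : m ≤ mΩ) (hX : Measurable[m] X) (hXi : Integrable X P)
    (hYm : Measurable[mΩ] Y) (hYi : Integrable Y P) (hY0 : P[Y] = 0)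
    (hind : Indep (MeasurableSpace.comap Y inferInstance) m P) :
    P[X + Y | m] =ᵐ[P] X := by
  have h1 := condExp_add hXi hYi m
  have h2 := condExp_indep_eq hYm.comap_le hm
    (comap_measurable Y).stronglyMeasurable hind
  have h3 := condExp_of_stronglyMeasurable hm hX.stronglyMeasurable hXi
  filter_upwards [h1, h2] with ω h1 h2
  rw [h1, Pi.add_apply, h2, h3, hY0, add_zero]

theorem condExp_mul_of_indep (hm : m ≤ mΩ) (hX : Measurable[m] X)
    (hXY : Integrable (X * Y) P) (hYm : Measurable[mΩ] Y) (hYi : Integrable Y P)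
    (hind : Indep (MeasurableSpace.comap Y inferInstance) m P) :
    P[X * Y | m] =ᵐ[P] fun ω => X ω * P[Y] := by
  have h1 := condExp_mul_of_stronglyMeasurable_left hX.stronglyMeasurable hXY hYi
  have h2 := condExp_indep_eq hYm.comap_le hm
    (comap_measurable Y).stronglyMeasurable hind
  filter_upwards [h1, h2] with ω h1 h2
  rw [h1, Pi.mul_apply, h2]

end

/-! ### The two martingale properties. -/

section

variable {Ω : Type*} {mΩ : MeasurableSpace Ω} {P : Measure Ω} {B : ℝ≥0 → Ω → ℝ}
  {fm fp : ℝ → ℝ} {C : ℝ} (hB : IsPreBrownianReal B P) (hBm : ∀ t, Measurable (B t))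
  (hm2 : MemLp fm 2 (volume.restrict (Set.Ici 0))) (hp2 : MemLp fp 2 (volume.restrict (Set.Ici 0)))

include hB hBm hm2 hp2

theorem isWienerIntegral_linearProcess {s t : ℝ≥0} (hst : s < t) :
    IsWienerIntegral B P (harnessIntegrand fm fp C s t) (linearProcess B P fm fp C s t) := by
  have h := (((isWienerIntegral_pastIntegral hB hm2 s).add hB (hm2.indicator measurableSet_Ioc)
    (hp2.indicator measurableSet_Ioi) (isWienerIntegral_futureIntegral hB hp2 t))).add hB
    ((hm2.indicator measurableSet_Ioc).add (hp2.indicator measurableSet_Ioi))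
    ((StepFunction.memLp_indicator_Ioc _ _ 2).const_mul _)
    ((isWienerIntegral_increment hBm s t hst.le).const_mul
      (harnessCoeff fm fp C s t / ((t : ℝ) - s)))
  have e : linearProcess B P fm fp C s t = fun ω => pastIntegral B P fm s ω
      + futureIntegral B P fp t ω
      + harnessCoeff fm fp C s t / ((t : ℝ) - s) * (B t ω - B s ω) := by
    ext ω
    unfold linearProcess
    ring
  rw [e]
  exact h

theorem exponentialProcess_eq {s t : ℝ≥0} (hst : s < t) (ω : Ω) :
    exponentialProcess B P fm fp C s t ω = Real.exp (linearProcess B P fm fp C s t ω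
      - Var[linearProcess B P fm fp C s t; P] / 2) := by
  have h4 : (t : ℝ) - s ≠ 0 := (sub_pos.2 (NNReal.coe_lt_coe.2 hst)).ne'
  rw [exponentialProcess, (isWienerIntegral_linearProcess hB hBm hm2 hp2 hst).variance_eq hB
    (memLp_harnessIntegrand hm2 hp2 s t), integral_harnessIntegrand_sq hm2 hp2 hst]
  congr 1
  field_simp
  ring

theorem integrable_linearProcess {s t : ℝ≥0} (hst : s < t) :
    Integrable (linearProcess B P fm fp C s t) P :=
  ((isWienerIntegral_linearProcess hB hBm hm2 hp2 hst).hasLaw hB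
    (memLp_harnessIntegrand hm2 hp2 s t)).hasGaussianLaw.integrable

theorem integrable_exponentialProcess {s t : ℝ≥0} (hst : s < t) :
    Integrable (exponentialProcess B P fm fp C s t) P := by
  simp only [funext (exponentialProcess_eq hB hBm hm2 hp2 hst), Real.exp_sub]
  exact (integrable_exp_of_hasLaw_gaussianReal
    ((isWienerIntegral_linearProcess hB hBm hm2 hp2 hst).hasLaw hB
      (memLp_harnessIntegrand hm2 hp2 s t))).div_const _

theorem isWienerIntegral_linearProcess_sub {r s t u : ℝ≥0} (hst : s < t) (hru : r < u) :
    IsWienerIntegral B P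
      (fun x => harnessIntegrand fm fp C s t x + (-1) * harnessIntegrand fm fp C r u x)
      fun ω => linearProcess B P fm fp C s t ω + (-1) * linearProcess B P fm fp C r u ω :=
  (isWienerIntegral_linearProcess hB hBm hm2 hp2 hst).add hB (memLp_harnessIntegrand hm2 hp2 s t)
    ((memLp_harnessIntegrand hm2 hp2 r u).const_mul (-1))
    ((isWienerIntegral_linearProcess hB hBm hm2 hp2 hru).const_mul (-1))

/-- The increment of `linearProcess` from `(r, u)` to `(s, t)` is independent of the past-future
σ-algebra at `(r, u)`. -/
theorem indep_linearProcess_sub (hm1 : IntegrableOn fm (Set.Ici 0))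
    (hp1 : IntegrableOn fp (Set.Ici 0)) {r s t u : ℝ≥0} (hrs : r < s) (hst : s < t) (htu : t < u) :
    Indep (MeasurableSpace.comap (fun ω => linearProcess B P fm fp C s t ω
        + (-1) * linearProcess B P fm fp C r u ω) inferInstance)
      ((naturalPastFuture B hBm P).seq r u) P := by
  have hru := (hrs.trans hst).trans htu
  have hL (s t : ℝ≥0) := memLp_harnessIntegrand (C := C) hm2 hp2 s t
  refine (isWienerIntegral_linearProcess_sub hB hBm hm2 hp2 hst hru).indep hB hBm
    ((hL s t).add ((hL r u).const_mul (-1))) _ fun v hv => ?_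
  have hi (s t : ℝ≥0) : IntegrableOn (harnessIntegrand fm fp C s t) (Set.Ioc (0 : ℝ) v) :=
    ((hL s t).mono_measure (Measure.restrict_mono_set _ fun x hx => hx.1.le)).integrable
      (by norm_num)
  simp only [Pi.add_apply]
  rw [integral_add (hi s t) ((hi r u).const_mul _), integral_const_mul]
  -- In either case both primitives at `v` have the same value, so their difference vanishes.
  rcases hv with hv | hv
  · rw [setIntegral_harnessIntegrand_of_le hst (hv.trans hrs.le),
      setIntegral_harnessIntegrand_of_le hru hv]
    ring
  · rw [setIntegral_harnessIntegrand_of_ge hm1 hp1 hst (htu.le.trans hv),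
      setIntegral_harnessIntegrand_of_ge hm1 hp1 hru hv]
    ring

theorem isPastFutureMartingale_linearProcess (hm1 : IntegrableOn fm (Set.Ici 0))
    (hp1 : IntegrableOn fp (Set.Ici 0)) :
    IsPastFutureMartingale (linearProcess B P fm fp C) (naturalPastFuture B hBm P) P where
  integrable _ _ hst := integrable_linearProcess hB hBm hm2 hp2 hst
  measurable _ _ hst := measurable_linearProcess hB hBm C hm2 hp2 hst
  condExp_eq r s t u hrs hst htu := by
    have := hB.isGaussianProcess.isProbabilityMeasure
    have hru := (hrs.trans hst).trans htu
    have hL (s t : ℝ≥0) := memLp_harnessIntegrand (C := C) hm2 hp2 s t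
    have hW := isWienerIntegral_linearProcess_sub (C := C) hB hBm hm2 hp2 hst hru
    have hlaw := hW.hasLaw hB ((hL s t).add ((hL r u).const_mul (-1)))
    -- The process at `(s, t)` is its value at `(r, u)` plus a centered increment independent of the
    -- conditioning σ-algebra.
    have h := condExp_add_of_indep ((naturalPastFuture B hBm P).le r u hru)
      (measurable_linearProcess hB hBm C hm2 hp2 hru)
      (integrable_linearProcess hB hBm hm2 hp2 hru) hW.1 hlaw.hasGaussianLaw.integrable
      (by rw [hlaw.integral_eq, integral_id_gaussianReal])
      (indep_linearProcess_sub hB hBm hm2 hp2 hm1 hp1 hrs hst htu)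
    convert h using 2
    ext ω
    simp only [Pi.add_apply]
    ring

theorem isPastFutureMartingale_exponentialProcess (hm1 : IntegrableOn fm (Set.Ici 0))
    (hp1 : IntegrableOn fp (Set.Ici 0)) :
    IsPastFutureMartingale (exponentialProcess B P fm fp C) (naturalPastFuture B hBm P) P where
  integrable _ _ hst := integrable_exponentialProcess hB hBm hm2 hp2 hst
  measurable _ _ hst := by
    simp only [funext (exponentialProcess_eq hB hBm hm2 hp2 hst)]
    exact ((measurable_linearProcess hB hBm C hm2 hp2 hst).sub_const _).exp
  condExp_eq r s t u hrs hst htu := by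
    have := hB.isGaussianProcess.isProbabilityMeasure
    have hru := (hrs.trans hst).trans htu
    have hL (s t : ℝ≥0) := memLp_harnessIntegrand (C := C) hm2 hp2 s t
    have hW := isWienerIntegral_linearProcess_sub (C := C) hB hBm hm2 hp2 hst hru
    have hlaw := hW.hasLaw hB ((hL s t).add ((hL r u).const_mul (-1)))
    have hind := indep_linearProcess_sub (C := C) hB hBm hm2 hp2 hm1 hp1 hrs hst htu
    have hmeas := measurable_linearProcess hB hBm C hm2 hp2 hru
    set D : Ω → ℝ := fun ω => linearProcess B P fm fp C s t ω
        + (-1) * linearProcess B P fm fp C r u ω with hD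
    have hDV : ((∫ x in Set.Ici (0 : ℝ), (harnessIntegrand fm fp C s t
        + fun x => (-1) * harnessIntegrand fm fp C r u x) x ^ 2).toNNReal : ℝ) = Var[D; P] := by
      rw [hlaw.variance_eq, variance_id_gaussianReal]
    have hsplit : linearProcess B P fm fp C s t = linearProcess B P fm fp C r u + D := by
      ext ω; simp [hD]
    -- Independence of `D` from the value at `(r, u)` makes the variances add, so the compensators
    -- in the exponent split as well.
    have hvar : Var[linearProcess B P fm fp C s t; P]
        = Var[linearProcess B P fm fp C r u; P] + Var[D; P] := by
      rw [hsplit]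
      refine IndepFun.variance_add ?_ ?_ ?_
      · exact (isWienerIntegral_linearProcess hB hBm hm2 hp2 hru).memLp hB (hL r u)
      · exact hlaw.hasGaussianLaw.memLp_two
      · rw [IndepFun_iff_Indep]
        exact (indep_of_indep_of_le_right hind hmeas.comap_le).symm
    have hexpD : ∫ ω, Real.exp (D ω) ∂P = Real.exp (Var[D; P] / 2) := by
      have := integral_exp_of_hasLaw_gaussianReal hlaw
      rw [zero_add] at this
      rw [this]
      exact congrArg (fun z => Real.exp (z / 2)) hDV
    have hprod : exponentialProcess B P fm fp C s t =
        exponentialProcess B P fm fp C r u * fun ω => Real.exp (D ω - Var[D; P] / 2) := by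
      ext ω
      rw [Pi.mul_apply, exponentialProcess_eq hB hBm hm2 hp2 hst,
        exponentialProcess_eq hB hBm hm2 hp2 hru, ← Real.exp_add, hvar, hsplit, Pi.add_apply]
      ring_nf
    have hint : ∫ ω, Real.exp (D ω - Var[D; P] / 2) ∂P = 1 := by
      simp only [Real.exp_sub, integral_div, hexpD]
      exact div_self (Real.exp_ne_zero _)
    have hinteg := integrable_exponentialProcess (C := C) hB hBm hm2 hp2 hst
    rw [hprod] at hinteg ⊢
    have h := condExp_mul_of_indep ((naturalPastFuture B hBm P).le r u hru)
      (X := exponentialProcess B P fm fp C r u) ?_ hinteg (hW.1.sub_const _).exp ?_ ?_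
    · simpa only [hint, mul_one] using h
    · simp only [funext (exponentialProcess_eq hB hBm hm2 hp2 hru)]
      exact (hmeas.sub_const _).exp
    · simp only [Real.exp_sub]
      exact (integrable_exp_of_hasLaw_gaussianReal hlaw).div_const _
    · refine indep_of_indep_of_le_left hind ?_
      exact Measurable.comap_le (((comap_measurable D).sub_const _).exp)

end

end PastFuture

theorem mainTheorem3 {Ω : Type*} {mΩ : MeasurableSpace Ω} (P : Measure Ω) (B : ℝ≥0 → Ω → ℝ)
    (hBm : ∀ t, Measurable (B t)) (hB : IsBrownianReal B P)
    (fm fp : ℝ → ℝ) (C : ℝ)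
    (hm1 : IntegrableOn fm (Set.Ici 0)) (hm2 : MemLp fm 2 (volume.restrict (Set.Ici 0)))
    (hp1 : IntegrableOn fp (Set.Ici 0)) (hp2 : MemLp fp 2 (volume.restrict (Set.Ici 0))) :
    (∀ s : ℝ≥0, PastFuture.IsWienerIntegral B P ((Set.Ioc (0 : ℝ) s).indicator fm)
      (PastFuture.pastIntegral B P fm s)) ∧
    (∀ t : ℝ≥0, PastFuture.IsWienerIntegral B P ((Set.Ioi (t : ℝ)).indicator fp)
      (PastFuture.futureIntegral B P fp t)) ∧
    PastFuture.IsPastFutureMartingale (PastFuture.linearProcess B P fm fp C)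
      (PastFuture.naturalPastFuture B hBm P) P ∧
    PastFuture.IsPastFutureMartingale (PastFuture.exponentialProcess B P fm fp C)
      (PastFuture.naturalPastFuture B hBm P) P := by
  have hB' := hB.toIsPreBrownianReal
  exact ⟨PastFuture.isWienerIntegral_pastIntegral hB' hm2,
    PastFuture.isWienerIntegral_futureIntegral hB' hp2,
    PastFuture.isPastFutureMartingale_linearProcess hB' hBm hm2 hp2 hm1 hp1,
    PastFuture.isPastFutureMartingale_exponentialProcess hB' hBm hm2 hp2 hm1 hp1⟩
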